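/- Throughout, rings are associative but not necessarily unital. A nonzero ring $R$ is prime if, for $a,b\in R$, $aRb=0$ implies $a=0$ or $b=0$. Let $Z(R)$ be the center of $R$, let $Q_s(R)$ be the Martindale symmetric ring of quotients of a prime ring $R$, and let the extended centroid $C$ be the center of $Q_s(R)$. A Lie ideal of $R$ is an additive subgroup $L$ of $R$ with $xr-rx\in L$ for all $x\in L$, $r\in R$; it is noncentral if $L\not\subseteq Z(R)$. For additive subgroups $A,B$ of a ring, $AB$ is the additive subgroup generated by all products $ab$ with $a\in A$, $b\in B$, and $A^1=A$, $A^{n+1}=A^nA$; the products $KC$ and $LC$ are formed in $Q_s(R)\supseteq R$. **Theorem.** Let $R$ be a prime ring with extended centroid $C$, let $K$ and $L$ be noncentral Lie ideals of $R$, and let $m,n\ge 1$ be integers. Then $K^mL^n$ contains a nonzero two-sided ideal of $R$ except precisely when $$KC=LC=Ca+C\quad\text{for every } a\in K\setminus Z(R).$$ That is, if this condition fails then $K^mL^n$ contains a nonzero ideal of $R$, and if it holds then $K^mL^n$ contains no nonzero ideal of $R$. -/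

import Mathlib

open scoped Pointwise

/-- A ring `R` (associative, not necessarily unital) is prime if it is nonzero and `a R b = 0`
implies `a = 0` or `b = 0`. -/
class IsPrimeRing (R : Type*) [NonUnitalRing R] : Prop extends Nontrivial R where
  eq_zero_or_eq_zero : ∀ a b : R, (∀ x : R, a * x * b = 0) → a = 0 ∨ b = 0

namespace IsPrimeRing

variable {R : Type*} [NonUnitalRing R] [IsPrimeRing R]

theorem exists_mul_mul_ne {a b : R} (ha : a ≠ 0) (hb : b ≠ 0) : ∃ x, a * x * b ≠ 0 := by
  by_contra! h
  exact (eq_zero_or_eq_zero a b h).elim ha hb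

theorem exists_mem_ne {I : TwoSidedIdeal R} (h : I ≠ ⊥) : ∃ a ∈ I, a ≠ 0 := by
  by_contra! h'
  exact h (TwoSidedIdeal.ext fun x => by
    rw [TwoSidedIdeal.mem_bot]
    exact ⟨h' x, fun hx => hx ▸ I.zero_mem⟩)

theorem ne_bot_of_mem {I : TwoSidedIdeal R} {a : R} (ha : a ∈ I) (h : a ≠ 0) : I ≠ ⊥ := by
  rintro rfl
  exact h ((TwoSidedIdeal.mem_bot R).1 ha)

theorem inf_ne_bot {I J : TwoSidedIdeal R} (hI : I ≠ ⊥) (hJ : J ≠ ⊥) : I ⊓ J ≠ ⊥ := by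
  obtain ⟨a, ha, ha0⟩ := exists_mem_ne hI
  obtain ⟨b, hb, hb0⟩ := exists_mem_ne hJ
  obtain ⟨x, hx⟩ := exists_mul_mul_ne ha0 hb0
  exact ne_bot_of_mem (I := I ⊓ J) ((TwoSidedIdeal.mem_inf R).2
    ⟨I.mul_mem_right _ _ (I.mul_mem_right _ _ ha), J.mul_mem_left _ _ hb⟩) hx

theorem top_ne_bot : (⊤ : TwoSidedIdeal R) ≠ ⊥ := by
  obtain ⟨a, ha⟩ := exists_ne (0 : R)
  exact ne_bot_of_mem (I := ⊤) (TwoSidedIdeal.mem_top R) ha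

end IsPrimeRing

/-! ## The Martindale symmetric ring of quotients

An element of `Q_s(R)` is represented by a triple `(f, g, I)`, where `I` is a nonzero ideal of `R`,
`f : I → R` is a homomorphism of right `R`-modules (to be thought of as `x ↦ q x`),
`g : I → R` is a homomorphism of left `R`-modules (to be thought of as `x ↦ x q`), and
`x (f y) = (g x) y` for all `x, y ∈ I`. Two triples represent the same element if they agree on
some nonzero ideal contained in both domains. -/

/-- A triple `(f, g, I)` as above. The maps are recorded as functions on `R`; their values outside
`I` are irrelevant. -/
structure MartindaleTriple (R : Type*) [NonUnitalRing R] where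
  I : TwoSidedIdeal R
  f : R → R
  g : R → R
  ne_bot : I ≠ ⊥
  f_add : ∀ x ∈ I, ∀ y ∈ I, f (x + y) = f x + f y
  f_mul : ∀ x ∈ I, ∀ r, f (x * r) = f x * r
  g_add : ∀ x ∈ I, ∀ y ∈ I, g (x + y) = g x + g y
  g_mul : ∀ x ∈ I, ∀ r, g (r * x) = r * g x
  balanced : ∀ x ∈ I, ∀ y ∈ I, x * f y = g x * y

namespace MartindaleTriple

variable {R : Type*} [NonUnitalRing R]

theorem f_zero (p : MartindaleTriple R) : p.f 0 = 0 := by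
  simpa using p.f_mul 0 p.I.zero_mem 0

theorem g_zero (p : MartindaleTriple R) : p.g 0 = 0 := by
  simpa using p.g_mul 0 p.I.zero_mem 0

theorem f_neg (p : MartindaleTriple R) {x : R} (hx : x ∈ p.I) : p.f (-x) = -p.f x := by
  have h := p.f_add x hx (-x) (p.I.neg_mem hx)
  rw [add_neg_cancel, f_zero] at h
  exact (neg_eq_of_add_eq_zero_right h.symm).symm

theorem g_neg (p : MartindaleTriple R) {x : R} (hx : x ∈ p.I) : p.g (-x) = -p.g x := by
  have h := p.g_add x hx (-x) (p.I.neg_mem hx)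
  rw [add_neg_cancel, g_zero] at h
  exact (neg_eq_of_add_eq_zero_right h.symm).symm

/-- Two triples agree on a nonzero ideal contained in both domains. -/
def Rel (p q : MartindaleTriple R) : Prop :=
  ∃ J : TwoSidedIdeal R, J ≠ ⊥ ∧ J ≤ p.I ∧ J ≤ q.I ∧ ∀ x ∈ J, p.f x = q.f x ∧ p.g x = q.g x

variable [IsPrimeRing R]

theorem rel_of_agree {p q : MartindaleTriple R} (J : TwoSidedIdeal R) (hJ : J ≠ ⊥)
    (h : ∀ x ∈ J, x ∈ p.I → x ∈ q.I → p.f x = q.f x ∧ p.g x = q.g x) : Rel p q :=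
  ⟨J ⊓ (p.I ⊓ q.I), IsPrimeRing.inf_ne_bot hJ (IsPrimeRing.inf_ne_bot p.ne_bot q.ne_bot),
    inf_le_right.trans inf_le_left, inf_le_right.trans inf_le_right,
    fun x hx => h x hx.1 hx.2.1 hx.2.2⟩

theorem rel_of_forall {p q : MartindaleTriple R}
    (h : ∀ x, x ∈ p.I → x ∈ q.I → p.f x = q.f x ∧ p.g x = q.g x) : Rel p q :=
  rel_of_agree ⊤ IsPrimeRing.top_ne_bot fun x _ => h x

instance setoid (R : Type*) [NonUnitalRing R] [IsPrimeRing R] :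
    Setoid (MartindaleTriple R) where
  r := Rel
  iseqv :=
    { refl := fun _ => rel_of_forall fun _ _ _ => ⟨rfl, rfl⟩
      symm := fun ⟨J, hJ, h1, h2, h⟩ =>
        ⟨J, hJ, h2, h1, fun x hx => ⟨(h x hx).1.symm, (h x hx).2.symm⟩⟩
      trans := fun ⟨J, hJ, _, _, h⟩ ⟨J', hJ', _, _, h'⟩ =>
        rel_of_agree (J ⊓ J') (IsPrimeRing.inf_ne_bot hJ hJ') fun x hx _ _ =>
          ⟨(h x hx.1).1.trans (h' x hx.2).1, (h x hx.1).2.trans (h' x hx.2).2⟩ }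

/-- An ideal inside `J` and the domain of `p` that both maps of `p` send into `J`. -/
def pre (p : MartindaleTriple R) (J : TwoSidedIdeal R) : TwoSidedIdeal R :=
  TwoSidedIdeal.mk'
    {x | (x ∈ J ∧ x ∈ p.I) ∧ (p.f x ∈ J ∧ ∀ r, p.f (r * x) ∈ J) ∧
      (p.g x ∈ J ∧ ∀ r, p.g (x * r) ∈ J)}
    (by simp [f_zero, g_zero])
    (by
      rintro x y ⟨⟨hx, hx'⟩, ⟨h1, h2⟩, h3, h4⟩ ⟨⟨hy, hy'⟩, ⟨k1, k2⟩, k3, k4⟩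
      refine ⟨⟨J.add_mem hx hy, p.I.add_mem hx' hy'⟩, ⟨?_, fun r => ?_⟩, ?_, fun r => ?_⟩
      · rw [p.f_add x hx' y hy']; exact J.add_mem h1 k1
      · rw [mul_add, p.f_add _ (p.I.mul_mem_left _ _ hx') _ (p.I.mul_mem_left _ _ hy')]
        exact J.add_mem (h2 r) (k2 r)
      · rw [p.g_add x hx' y hy']; exact J.add_mem h3 k3
      · rw [add_mul, p.g_add _ (p.I.mul_mem_right _ _ hx') _ (p.I.mul_mem_right _ _ hy')]
        exact J.add_mem (h4 r) (k4 r))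
    (by
      rintro x ⟨⟨hx, hx'⟩, ⟨h1, h2⟩, h3, h4⟩
      refine ⟨⟨J.neg_mem hx, p.I.neg_mem hx'⟩, ⟨?_, fun r => ?_⟩, ?_, fun r => ?_⟩
      · rw [p.f_neg hx']; exact J.neg_mem h1
      · rw [mul_neg, p.f_neg (p.I.mul_mem_left _ _ hx')]; exact J.neg_mem (h2 r)
      · rw [p.g_neg hx']; exact J.neg_mem h3
      · rw [neg_mul, p.g_neg (p.I.mul_mem_right _ _ hx')]; exact J.neg_mem (h4 r))
    (by
      rintro s x ⟨⟨hx, hx'⟩, ⟨h1, h2⟩, h3, h4⟩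
      refine ⟨⟨J.mul_mem_left _ _ hx, p.I.mul_mem_left _ _ hx'⟩, ⟨h2 s, fun r => ?_⟩, ?_,
        fun r => ?_⟩
      · rw [← mul_assoc]; exact h2 _
      · rw [p.g_mul x hx']; exact J.mul_mem_left _ _ h3
      · rw [mul_assoc, p.g_mul _ (p.I.mul_mem_right _ _ hx')]; exact J.mul_mem_left _ _ (h4 r))
    (by
      rintro x s ⟨⟨hx, hx'⟩, ⟨h1, h2⟩, h3, h4⟩
      refine ⟨⟨J.mul_mem_right _ _ hx, p.I.mul_mem_right _ _ hx'⟩, ⟨?_, fun r => ?_⟩, h4 s,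
        fun r => ?_⟩
      · rw [p.f_mul x hx']; exact J.mul_mem_right _ _ h1
      · rw [← mul_assoc, p.f_mul _ (p.I.mul_mem_left _ _ hx')]; exact J.mul_mem_right _ _ (h2 r)
      · rw [mul_assoc]; exact h4 _)

theorem mem_pre {p : MartindaleTriple R} {J : TwoSidedIdeal R} {x : R} :
    x ∈ p.pre J ↔ (x ∈ J ∧ x ∈ p.I) ∧ (p.f x ∈ J ∧ ∀ r, p.f (r * x) ∈ J) ∧
      (p.g x ∈ J ∧ ∀ r, p.g (x * r) ∈ J) :=
  TwoSidedIdeal.mem_mk' _ _ _ _ _ _ _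

theorem pre_ne_bot (p : MartindaleTriple R) {J : TwoSidedIdeal R} (hJ : J ≠ ⊥) :
    p.pre J ≠ ⊥ := by
  obtain ⟨a, ⟨haJ, haI⟩, ha⟩ := IsPrimeRing.exists_mem_ne (IsPrimeRing.inf_ne_bot hJ p.ne_bot)
  obtain ⟨r, hr⟩ := IsPrimeRing.exists_mul_mul_ne ha ha
  replace haJ : a ∈ J := haJ
  replace haI : a ∈ p.I := haI
  refine IsPrimeRing.ne_bot_of_mem (a := a * r * a) (mem_pre.2 ⟨⟨J.mul_mem_left _ _ haJ,
    p.I.mul_mem_left _ _ haI⟩, ⟨?_, fun s => ?_⟩, ?_, fun s => ?_⟩) hr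
  · rw [mul_assoc, p.f_mul a haI]
    exact J.mul_mem_left _ _ (J.mul_mem_left _ _ haJ)
  · rw [mul_assoc, ← mul_assoc s, p.f_mul _ (p.I.mul_mem_left _ _ haI)]
    exact J.mul_mem_left _ _ (J.mul_mem_left _ _ haJ)
  · rw [p.g_mul a haI]
    exact J.mul_mem_right _ _ (J.mul_mem_right _ _ haJ)
  · rw [mul_assoc, p.g_mul _ (p.I.mul_mem_right _ _ haI)]
    exact J.mul_mem_right _ _ (J.mul_mem_right _ _ haJ)

/-- The triple of multiplications by an element of `R`. -/
def ofRing (r : R) : MartindaleTriple R where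
  I := ⊤
  f x := r * x
  g x := x * r
  ne_bot := IsPrimeRing.top_ne_bot
  f_add _ _ _ _ := mul_add _ _ _
  f_mul _ _ _ := (mul_assoc _ _ _).symm
  g_add _ _ _ _ := add_mul _ _ _
  g_mul _ _ _ := mul_assoc _ _ _
  balanced _ _ _ _ := (mul_assoc _ _ _).symm

/-- The triple of identity maps. -/
protected def one : MartindaleTriple R where
  I := ⊤
  f x := x
  g x := x
  ne_bot := IsPrimeRing.top_ne_bot
  f_add _ _ _ _ := rfl
  f_mul _ _ _ := rfl
  g_add _ _ _ _ := rfl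
  g_mul _ _ _ := rfl
  balanced _ _ _ _ := rfl

/-- Pointwise sum on the intersection of the domains. -/
protected def add (p q : MartindaleTriple R) : MartindaleTriple R where
  I := p.I ⊓ q.I
  f x := p.f x + q.f x
  g x := p.g x + q.g x
  ne_bot := IsPrimeRing.inf_ne_bot p.ne_bot q.ne_bot
  f_add x hx y hy := by rw [p.f_add x hx.1 y hy.1, q.f_add x hx.2 y hy.2]; abel
  f_mul x hx r := by rw [p.f_mul x hx.1, q.f_mul x hx.2, add_mul]
  g_add x hx y hy := by rw [p.g_add x hx.1 y hy.1, q.g_add x hx.2 y hy.2]; abel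
  g_mul x hx r := by rw [p.g_mul x hx.1, q.g_mul x hx.2, mul_add]
  balanced x hx y hy := by
    rw [mul_add, add_mul, p.balanced x hx.1 y hy.1, q.balanced x hx.2 y hy.2]

/-- Pointwise negative. -/
protected def neg (p : MartindaleTriple R) : MartindaleTriple R where
  I := p.I
  f x := -p.f x
  g x := -p.g x
  ne_bot := p.ne_bot
  f_add x hx y hy := by rw [p.f_add x hx y hy]; abel
  f_mul x hx r := by rw [p.f_mul x hx, neg_mul]
  g_add x hx y hy := by rw [p.g_add x hx y hy]; abel
  g_mul x hx r := by rw [p.g_mul x hx, mul_neg]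
  balanced x hx y hy := by rw [mul_neg, neg_mul, p.balanced x hx y hy]

/-- Composition: `(pq) x = p (q x)` and `x (pq) = (x p) q`, on an ideal where both make sense. -/
protected def mul (p q : MartindaleTriple R) : MartindaleTriple R where
  I := q.pre p.I ⊓ p.pre q.I
  f x := p.f (q.f x)
  g x := q.g (p.g x)
  ne_bot := IsPrimeRing.inf_ne_bot (q.pre_ne_bot p.ne_bot) (p.pre_ne_bot q.ne_bot)
  f_add x hx y hy := by
    obtain ⟨⟨_, a⟩, ⟨b, _⟩, _⟩ := mem_pre.1 hx.1
    obtain ⟨⟨_, a'⟩, ⟨b', _⟩, _⟩ := mem_pre.1 hy.1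
    rw [q.f_add x a y a', p.f_add _ b _ b']
  f_mul x hx r := by
    obtain ⟨⟨_, a⟩, ⟨b, _⟩, _⟩ := mem_pre.1 hx.1
    rw [q.f_mul x a, p.f_mul _ b]
  g_add x hx y hy := by
    obtain ⟨⟨_, a⟩, _, ⟨b, _⟩⟩ := mem_pre.1 hx.2
    obtain ⟨⟨_, a'⟩, _, ⟨b', _⟩⟩ := mem_pre.1 hy.2
    rw [p.g_add x a y a', q.g_add _ b _ b']
  g_mul x hx r := by
    obtain ⟨⟨_, a⟩, _, ⟨b, _⟩⟩ := mem_pre.1 hx.2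
    rw [p.g_mul x a, q.g_mul _ b]
  balanced x hx y hy := by
    obtain ⟨⟨_, a⟩, _, ⟨b, _⟩⟩ := mem_pre.1 hx.2
    obtain ⟨⟨_, a'⟩, ⟨b', _⟩, _⟩ := mem_pre.1 hy.1
    rw [p.balanced x a _ b', q.balanced _ b y a']

end MartindaleTriple

/-- The Martindale symmetric ring of quotients `Q_s(R)` of a prime ring `R`. -/
def SymmetricQuotientRing (R : Type*) [NonUnitalRing R] [IsPrimeRing R] : Type _ :=
  Quotient (MartindaleTriple.setoid R)

namespace SymmetricQuotientRing

variable {R : Type*} [NonUnitalRing R] [IsPrimeRing R]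

/-- The element of `Q_s(R)` represented by a triple. -/
def mk (p : MartindaleTriple R) : SymmetricQuotientRing R :=
  Quotient.mk (MartindaleTriple.setoid R) p

theorem mk_eq_mk {p q : MartindaleTriple R} : mk p = mk q ↔ p.Rel q :=
  Quotient.eq (r := MartindaleTriple.setoid R)

instance : Zero (SymmetricQuotientRing R) := ⟨mk (MartindaleTriple.ofRing 0)⟩

instance : One (SymmetricQuotientRing R) := ⟨mk MartindaleTriple.one⟩

instance : Add (SymmetricQuotientRing R) :=
  ⟨Quotient.map₂ MartindaleTriple.add (by
    rintro p p' ⟨J, hJ, _, _, h⟩ q q' ⟨J', hJ', _, _, h'⟩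
    refine MartindaleTriple.rel_of_agree (J ⊓ J') (IsPrimeRing.inf_ne_bot hJ hJ')
      fun x hx _ _ => ⟨?_, ?_⟩
    · exact congrArg₂ (· + ·) (h x hx.1).1 (h' x hx.2).1
    · exact congrArg₂ (· + ·) (h x hx.1).2 (h' x hx.2).2)⟩

instance : Neg (SymmetricQuotientRing R) :=
  ⟨Quotient.map MartindaleTriple.neg (by
    rintro p p' ⟨J, hJ, _, _, h⟩
    exact MartindaleTriple.rel_of_agree J hJ fun x hx _ _ =>
      ⟨congrArg (- ·) (h x hx).1, congrArg (- ·) (h x hx).2⟩)⟩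

instance : Mul (SymmetricQuotientRing R) :=
  ⟨Quotient.map₂ MartindaleTriple.mul (by
    rintro p p' ⟨J, hJ, _, _, h⟩ q q' ⟨J', hJ', _, _, h'⟩
    refine MartindaleTriple.rel_of_agree (q.pre J ⊓ p.pre J')
      (IsPrimeRing.inf_ne_bot (q.pre_ne_bot hJ) (p.pre_ne_bot hJ')) fun x hx _ _ => ?_
    obtain ⟨⟨xJ, _⟩, ⟨qx, _⟩, _⟩ := MartindaleTriple.mem_pre.1 hx.1
    obtain ⟨⟨xJ', _⟩, _, ⟨px, _⟩⟩ := MartindaleTriple.mem_pre.1 hx.2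
    constructor
    · change p.f (q.f x) = p'.f (q'.f x)
      rw [(h _ qx).1, (h' x xJ').1]
    · change q.g (p.g x) = q'.g (p'.g x)
      rw [(h' _ px).2, (h x xJ).2])⟩

theorem mk_add (p q : MartindaleTriple R) : mk p + mk q = mk (p.add q) := rfl

theorem mk_neg (p : MartindaleTriple R) : -mk p = mk p.neg := rfl

theorem mk_mul (p q : MartindaleTriple R) : mk p * mk q = mk (p.mul q) := rfl

theorem zero_def : (0 : SymmetricQuotientRing R) = mk (MartindaleTriple.ofRing 0) := rfl

theorem one_def : (1 : SymmetricQuotientRing R) = mk MartindaleTriple.one := rfl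

theorem mk_eq_of_forall {p q : MartindaleTriple R}
    (h : ∀ x, x ∈ p.I → x ∈ q.I → p.f x = q.f x ∧ p.g x = q.g x) : mk p = mk q :=
  mk_eq_mk.2 (MartindaleTriple.rel_of_forall h)

theorem ind {P : SymmetricQuotientRing R → Prop} (h : ∀ p, P (mk p)) (a) : P a :=
  Quotient.ind h a

instance : Ring (SymmetricQuotientRing R) where
  add_assoc := by
    refine ind fun p => ind fun q => ind fun r => mk_eq_of_forall fun x _ _ => ⟨?_, ?_⟩
    · exact add_assoc (p.f x) (q.f x) (r.f x)
    · exact add_assoc (p.g x) (q.g x) (r.g x)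
  zero_add := by
    refine ind fun p => mk_eq_of_forall fun x _ _ => ⟨?_, ?_⟩
    · change 0 * x + p.f x = p.f x
      rw [zero_mul, zero_add]
    · change x * 0 + p.g x = p.g x
      rw [mul_zero, zero_add]
  add_zero := by
    refine ind fun p => mk_eq_of_forall fun x _ _ => ⟨?_, ?_⟩
    · change p.f x + 0 * x = p.f x
      rw [zero_mul, add_zero]
    · change p.g x + x * 0 = p.g x
      rw [mul_zero, add_zero]
  add_comm := by
    refine ind fun p => ind fun q => mk_eq_of_forall fun x _ _ => ⟨?_, ?_⟩
    · exact add_comm (p.f x) (q.f x)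
    · exact add_comm (p.g x) (q.g x)
  neg_add_cancel := by
    refine ind fun p => mk_eq_of_forall fun x _ _ => ⟨?_, ?_⟩
    · change -p.f x + p.f x = 0 * x
      rw [zero_mul, neg_add_cancel]
    · change -p.g x + p.g x = x * 0
      rw [mul_zero, neg_add_cancel]
  mul_assoc := by
    exact ind fun p => ind fun q => ind fun r => mk_eq_of_forall fun x _ _ => ⟨rfl, rfl⟩
  one_mul := ind fun p => mk_eq_of_forall fun x _ _ => ⟨rfl, rfl⟩
  mul_one := ind fun p => mk_eq_of_forall fun x _ _ => ⟨rfl, rfl⟩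
  zero_mul := by
    refine ind fun p => mk_eq_of_forall fun x _ _ => ⟨?_, ?_⟩
    · change 0 * p.f x = 0 * x
      rw [zero_mul, zero_mul]
    · change p.g (x * 0) = x * 0
      rw [mul_zero, p.g_zero]
  mul_zero := by
    refine ind fun p => mk_eq_of_forall fun x _ _ => ⟨?_, ?_⟩
    · change p.f (0 * x) = 0 * x
      rw [zero_mul, p.f_zero]
    · change p.g x * 0 = x * 0
      rw [mul_zero, mul_zero]
  left_distrib := by
    refine ind fun p => ind fun q => ind fun r => mk_eq_of_forall fun x _ hx => ⟨?_, rfl⟩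
    obtain ⟨_, ⟨hq, _⟩, _⟩ := MartindaleTriple.mem_pre.1 hx.1.1
    obtain ⟨_, ⟨hr, _⟩, _⟩ := MartindaleTriple.mem_pre.1 hx.2.1
    exact p.f_add _ hq _ hr
  right_distrib := by
    refine ind fun p => ind fun q => ind fun r => mk_eq_of_forall fun x _ hx => ⟨rfl, ?_⟩
    obtain ⟨_, _, ⟨hp, _⟩⟩ := MartindaleTriple.mem_pre.1 hx.1.2
    obtain ⟨_, _, ⟨hq, _⟩⟩ := MartindaleTriple.mem_pre.1 hx.2.2
    exact r.g_add _ hp _ hq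
  nsmul := nsmulRec
  zsmul := zsmulRec

variable (R) in
/-- The canonical embedding of `R` into `Q_s(R)`. -/
def of : R →ₙ+* SymmetricQuotientRing R where
  toFun r := mk (MartindaleTriple.ofRing r)
  map_mul' a b := mk_eq_of_forall fun x _ _ => ⟨mul_assoc a b x, (mul_assoc x a b).symm⟩
  map_zero' := rfl
  map_add' a b := mk_eq_of_forall fun x _ _ => ⟨add_mul a b x, mul_add x a b⟩

end SymmetricQuotientRing

/-- The extended centroid `C` of a prime ring `R`: the center of `Q_s(R)`. -/
def extendedCentroid (R : Type*) [NonUnitalRing R] [IsPrimeRing R] :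
    Subring (SymmetricQuotientRing R) :=
  Subring.center (SymmetricQuotientRing R)

/-- `AC` for an additive subgroup `A` of `R`: the additive subgroup of `Q_s(R)` generated by all
products `a c` with `a ∈ A` and `c ∈ C`. -/
def mulExtendedCentroid {R : Type*} [NonUnitalRing R] [IsPrimeRing R] (A : AddSubgroup R) :
    AddSubgroup (SymmetricQuotientRing R) :=
  A.map (SymmetricQuotientRing.of R).toAddMonoidHom * (extendedCentroid R).toAddSubgroup

/-- The set `C a + C` for an element `a` of `R`. -/
def centroidLine {R : Type*} [NonUnitalRing R] [IsPrimeRing R] (a : R) :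
    Set (SymmetricQuotientRing R) :=
  {q | ∃ c ∈ extendedCentroid R, ∃ d ∈ extendedCentroid R, q = c * SymmetricQuotientRing.of R a + d}

/-- `L` is a Lie ideal of `R`: an additive subgroup with `[L, R] ⊆ L`. -/
def IsLieIdeal {R : Type*} [NonUnitalRing R] (L : AddSubgroup R) : Prop :=
  ∀ x ∈ L, ∀ r : R, x * r - r * x ∈ L

/-- `L` is central: `L ⊆ Z(R)`. -/
def IsCentral {R : Type*} [NonUnitalRing R] (L : AddSubgroup R) : Prop :=
  ∀ x ∈ L, x ∈ NonUnitalSubring.center R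

/-- The power `L ^ n` for `n ≥ 1`, where the product of two additive subgroups is the additive
subgroup generated by the products of their elements. -/
def addSubgroupPow {R : Type*} [NonUnitalRing R] (L : AddSubgroup R) (n : ℕ+) : AddSubgroup R :=
  PNat.recOn n L fun _ M => M * L

/-- `A` contains a nonzero two-sided ideal of `R`. -/
def ContainsNonzeroIdeal {R : Type*} [NonUnitalRing R] (A : AddSubgroup R) : Prop :=
  ∃ I : TwoSidedIdeal R, I ≠ ⊥ ∧ ∀ x ∈ I, x ∈ A

/-! The theorem turns on whether `K` and `L` commute elementwise. If `a ∈ K` and `b ∈ L` do not, put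
c = [a,b]. Leibniz identities put y c [b,w] into `K * L` for all y, and primeness gives w with c
[b,w] ≠ 0. Since `K * L` is a Lie ideal it then contains a nonzero ideal
(`containsNonzeroIdeal_mul_of_ne`), and further factors of `K` and `L` can be absorbed
(`ContainsNonzeroIdeal.pow_mul_pow`). If they commute, then [a,[b,r]] = 0 for all r, and for
noncentral a Martindale's argument gives b = ca + d over the extended centroid
(`exists_eq_mul_add`). By symmetry `K` and `L` lie on the same line Ca + C, and they fill it after
extension to C (`mulExtendedCentroid_eq_centroidLine`). Conversely, if both lie on Ca + C with a
noncentral, every product lies in the commutative double centralizer of a. A nonzero ideal there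
would make `R` commutative (`not_containsNonzeroIdeal`). -/

namespace IsPrimeRing

variable {R : Type*} [NonUnitalRing R] [IsPrimeRing R]

/-! ### Nonzero ideals of a prime ring. -/

theorem eq_zero_of_forall_mem_mul {I : TwoSidedIdeal R} (hI : I ≠ ⊥) {c : R}
    (h : ∀ x ∈ I, x * c = 0) : c = 0 := by
  obtain ⟨x, hx, hx0⟩ := exists_mem_ne hI
  exact (eq_zero_or_eq_zero x c fun r => h _ (I.mul_mem_right _ _ hx)).resolve_left hx0

theorem eq_zero_of_forall_mul_mem {I : TwoSidedIdeal R} (hI : I ≠ ⊥) {c : R}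
    (h : ∀ x ∈ I, c * x = 0) : c = 0 := by
  obtain ⟨x, hx, hx0⟩ := exists_mem_ne hI
  exact (eq_zero_or_eq_zero c x fun r => by
    rw [mul_assoc]; exact h _ (I.mul_mem_left _ _ hx)).resolve_right hx0

/-- A prime ring with a nonzero commutative ideal is commutative. -/
theorem mul_comm_of_ideal {I : TwoSidedIdeal R} (hI : I ≠ ⊥)
    (h : ∀ x ∈ I, ∀ y ∈ I, x * y = y * x) (r s : R) : r * s = s * r := by
  -- For x in `I`, both x r and x commute with y, so x(ry − yr) = 0.
  have central : ∀ y ∈ I, ∀ r, r * y = y * r := fun y hy r => by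
    refine sub_eq_zero.1 (eq_zero_of_forall_mem_mul hI fun x hx => ?_)
    rw [mul_sub, ← mul_assoc, ← mul_assoc, h _ (I.mul_mem_right x r hx) y hy, h x hx y hy,
      mul_assoc, sub_self]
  refine sub_eq_zero.1 (eq_zero_of_forall_mem_mul hI fun y hy => ?_)
  rw [mul_sub, ← mul_assoc, ← mul_assoc, ← central y hy r, mul_assoc,
    ← central _ (I.mul_mem_right y s hy) r, sub_self]

end IsPrimeRing

/-! ### Products of additive subgroups. -/

namespace AddSubgroup

variable {R : Type*} [NonUnitalRing R]

theorem mul_mem_mul {A B : AddSubgroup R} {a b : R} (ha : a ∈ A) (hb : b ∈ B) : a * b ∈ A * B :=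
  AddSubmonoid.mul_mem_mul (M := A.toAddSubmonoid) (N := B.toAddSubmonoid) ha hb

theorem mul_le_iff {A B D : AddSubgroup R} : A * B ≤ D ↔ ∀ a ∈ A, ∀ b ∈ B, a * b ∈ D :=
  AddSubmonoid.mul_le (M := A.toAddSubmonoid) (N := B.toAddSubmonoid) (P := D.toAddSubmonoid)

theorem mul_assoc_pointwise (A B D : AddSubgroup R) : A * B * D = A * (B * D) :=
  toAddSubmonoid_injective (mul_assoc A.toAddSubmonoid B.toAddSubmonoid D.toAddSubmonoid)

end AddSubgroup

/-! ### Products of Lie ideals, and ideals inside them. -/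

section LieIdeal

variable {R : Type*} [NonUnitalRing R]

/-- The largest two-sided ideal contained in an additive subgroup. -/
def idealCore (P : AddSubgroup R) : TwoSidedIdeal R :=
  TwoSidedIdeal.mk' {t | t ∈ P ∧ (∀ y, y * t ∈ P) ∧ (∀ v, t * v ∈ P) ∧ ∀ y v, y * t * v ∈ P}
    (by simp [P.zero_mem])
    (fun ⟨h1, h2, h3, h4⟩ ⟨k1, k2, k3, k4⟩ => ⟨P.add_mem h1 k1,
      fun y => by rw [mul_add]; exact P.add_mem (h2 y) (k2 y),
      fun v => by rw [add_mul]; exact P.add_mem (h3 v) (k3 v),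
      fun y v => by rw [mul_add, add_mul]; exact P.add_mem (h4 y v) (k4 y v)⟩)
    (fun ⟨h1, h2, h3, h4⟩ => ⟨P.neg_mem h1,
      fun y => by rw [mul_neg]; exact P.neg_mem (h2 y),
      fun v => by rw [neg_mul]; exact P.neg_mem (h3 v),
      fun y v => by rw [mul_neg, neg_mul]; exact P.neg_mem (h4 y v)⟩)
    (fun {s t} ⟨_, h2, _, h4⟩ => ⟨h2 s, fun y => by rw [← mul_assoc]; exact h2 _, h4 s,
      fun y v => by rw [← mul_assoc]; exact h4 _ _⟩)
    (fun {t s} ⟨_, _, h3, h4⟩ => ⟨h3 s, fun y => by rw [← mul_assoc]; exact h4 _ _,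
      fun v => by rw [mul_assoc]; exact h3 _,
      fun y v => by rw [← mul_assoc, mul_assoc]; exact h4 _ _⟩)

theorem mem_idealCore {P : AddSubgroup R} {t : R} : t ∈ idealCore P ↔
    t ∈ P ∧ (∀ y, y * t ∈ P) ∧ (∀ v, t * v ∈ P) ∧ ∀ y v, y * t * v ∈ P :=
  TwoSidedIdeal.mem_mk' _ _ _ _ _ _ _

/-- Without a unit, t itself need not lie in `P`. In the witness below some t has factors on both
sides, so the witness and all its multiples have the form y t v. Applying primeness twice keeps it
nonzero. -/
theorem ContainsNonzeroIdeal.of_forall_mul_mul_mem [IsPrimeRing R] {P : AddSubgroup R} {t : R}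
    (ht : t ≠ 0) (h : ∀ y v, y * t * v ∈ P) : ContainsNonzeroIdeal P := by
  obtain ⟨x, hx⟩ := IsPrimeRing.exists_mul_mul_ne ht ht
  obtain ⟨z, hz⟩ := IsPrimeRing.exists_mul_mul_ne hx hx
  refine ⟨idealCore P, IsPrimeRing.ne_bot_of_mem (a := t * x * t * z * (t * x * t))
    (mem_idealCore.2 ⟨?_, fun y => ?_, fun v => ?_, fun y v => ?_⟩) hz,
    fun x hx => (mem_idealCore.1 hx).1⟩
  · simpa only [mul_assoc] using h (t * x) (z * (t * x * t))
  · simpa only [mul_assoc] using h (y * (t * x)) (z * (t * x * t))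
  · simpa only [mul_assoc] using h (t * x) (z * (t * x * t) * v)
  · simpa only [mul_assoc] using h (y * (t * x)) (z * (t * x * t) * v)

theorem IsLieIdeal.mul {A B : AddSubgroup R} (hA : IsLieIdeal A) (hB : IsLieIdeal B) :
    IsLieIdeal (A * B) := by
  intro x hx r
  refine AddSubmonoid.mul_induction_on (C := fun x => x * r - r * x ∈ A * B) hx
    (fun a ha b hb => ?_) fun x y hx hy => ?_
  · have h := (A * B).add_mem (AddSubgroup.mul_mem_mul ha (hB b hb r))
      (AddSubgroup.mul_mem_mul (hA a ha r) hb)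
    convert h using 1
    noncomm_ring
  · convert (A * B).add_mem hx hy using 1
    noncomm_ring

theorem exists_ne_zero_of_not_isCentral {A : AddSubgroup R} (h : ¬ IsCentral A) : ∃ a ∈ A, a ≠ 0 := by
  by_contra! h'
  exact h fun x hx => h' x hx ▸ zero_mem _

/-- If all products vanish, then 0 = a[b,r] = abr − arb forces a r b = 0. -/
theorem IsLieIdeal.exists_mul_ne_zero [IsPrimeRing R] {A B : AddSubgroup R}
    (hB : IsLieIdeal B) (hA0 : ∃ a ∈ A, a ≠ 0) (hB0 : ∃ b ∈ B, b ≠ 0) : ∃ x ∈ A * B, x ≠ 0 := by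
  by_contra! h
  obtain ⟨a, ha, ha0⟩ := hA0
  obtain ⟨b, hb, hb0⟩ := hB0
  refine (IsPrimeRing.eq_zero_or_eq_zero a b fun r => ?_).elim ha0 hb0
  have h1 := h _ (AddSubgroup.mul_mem_mul ha hb)
  have h2 := h _ (AddSubgroup.mul_mem_mul ha (hB b hb r))
  rw [mul_sub, ← mul_assoc, h1, zero_mul, zero_sub, neg_eq_zero, ← mul_assoc] at h2
  exact h2

theorem addSubgroupPow_one (L : AddSubgroup R) : addSubgroupPow L 1 = L := rfl

theorem addSubgroupPow_succ (L : AddSubgroup R) (n : ℕ+) :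
    addSubgroupPow L (n + 1) = addSubgroupPow L n * L :=
  PNat.recOn_succ n (p := fun _ => AddSubgroup R) L _

theorem IsLieIdeal.pow {L : AddSubgroup R} (hL : IsLieIdeal L) (n : ℕ+) :
    IsLieIdeal (addSubgroupPow L n) := by
  induction n using PNat.recOn with
  | one => exact hL
  | succ n ih => rw [addSubgroupPow_succ]; exact ih.mul hL

theorem IsLieIdeal.exists_pow_ne_zero [IsPrimeRing R] {L : AddSubgroup R} (hL : IsLieIdeal L)
    (hL0 : ∃ b ∈ L, b ≠ 0) (n : ℕ+) : ∃ x ∈ addSubgroupPow L n, x ≠ 0 := by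
  induction n using PNat.recOn with
  | one => exact hL0
  | succ n ih => rw [addSubgroupPow_succ]; exact hL.exists_mul_ne_zero ih hL0

/-- For j in the ideal, y(aj)v = a(yjv) − [a,y](jv), so t = aj generates an ideal inside the
product. -/
theorem ContainsNonzeroIdeal.mul_left [IsPrimeRing R] {A B : AddSubgroup R}
    (hB : ContainsNonzeroIdeal B) (hA : IsLieIdeal A) (hA0 : ∃ a ∈ A, a ≠ 0) :
    ContainsNonzeroIdeal (A * B) := by
  obtain ⟨J, hJ, hJB⟩ := hB
  obtain ⟨a, ha, ha0⟩ := hA0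
  obtain ⟨j, hj, hj0⟩ : ∃ j ∈ J, a * j ≠ 0 := by
    by_contra! h
    exact ha0 (IsPrimeRing.eq_zero_of_forall_mul_mem hJ h)
  refine .of_forall_mul_mul_mem hj0 fun y v => ?_
  have h := (A * B).sub_mem
    (AddSubgroup.mul_mem_mul ha (hJB _ (J.mul_mem_left y _ (J.mul_mem_right _ v hj))))
    (AddSubgroup.mul_mem_mul (hA a ha y) (hJB _ (J.mul_mem_right _ v hj)))
  convert h using 1
  noncomm_ring

theorem ContainsNonzeroIdeal.mul_right [IsPrimeRing R] {A B : AddSubgroup R}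
    (hA : ContainsNonzeroIdeal A) (hB : IsLieIdeal B) (hB0 : ∃ b ∈ B, b ≠ 0) :
    ContainsNonzeroIdeal (A * B) := by
  obtain ⟨J, hJ, hJA⟩ := hA
  obtain ⟨b, hb, hb0⟩ := hB0
  obtain ⟨j, hj, hj0⟩ : ∃ j ∈ J, j * b ≠ 0 := by
    by_contra! h
    exact hb0 (IsPrimeRing.eq_zero_of_forall_mem_mul hJ h)
  refine .of_forall_mul_mul_mem hj0 fun y v => ?_
  have h := (A * B).add_mem
    (AddSubgroup.mul_mem_mul (hJA _ (J.mul_mem_right _ v (J.mul_mem_left y _ hj))) hb)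
    (AddSubgroup.mul_mem_mul (hJA _ (J.mul_mem_left y _ hj)) (hB b hb v))
  convert h using 1
  noncomm_ring

/-- If two Lie ideals do not commute elementwise, their product contains a nonzero ideal. -/
theorem containsNonzeroIdeal_mul_of_ne [IsPrimeRing R] {K L : AddSubgroup R} (hK : IsLieIdeal K)
    (hL : IsLieIdeal L) {a b : R} (ha : a ∈ K) (hb : b ∈ L) (hab : a * b ≠ b * a) :
    ContainsNonzeroIdeal (K * L) := by
  have hc : a * b - b * a ≠ 0 := sub_ne_zero.2 hab
  obtain ⟨r, hr⟩ := IsPrimeRing.exists_mul_mul_ne hc hc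
  -- Write c = [a,b]. If c[b,w] = 0 for every w, taking w = r and w = ra gives c r c = c[b,r]a −
  -- c[b,ra] = 0, against the choice of r.
  obtain ⟨w, hw⟩ : ∃ w, (a * b - b * a) * (b * w - w * b) ≠ 0 := by
    by_contra! h
    refine hr ?_
    have h1 := h (r * a)
    have h2 := congrArg (· * a) (h r)
    have h3 : (a * b - b * a) * r * (a * b - b * a) =
        (a * b - b * a) * (b * r - r * b) * a - (a * b - b * a) * (b * (r * a) - r * a * b) := by
      noncomm_ring
    simpa only [h1, h2, zero_mul, sub_zero] using h3
  -- [a,yb][b,w] − [a,y][b,bw] = y[a,b][b,w].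
  have left : ∀ y, y * ((a * b - b * a) * (b * w - w * b)) ∈ K * L := fun y => by
    have h := (K * L).sub_mem (AddSubgroup.mul_mem_mul (hK a ha (y * b)) (hL b hb w))
      (AddSubgroup.mul_mem_mul (hK a ha y) (hL b hb (b * w)))
    convert h using 1
    noncomm_ring
  refine .of_forall_mul_mul_mem hw fun y v => ?_
  -- For t = [a,b][b,w], ytv = [yt,v] + (vy)t turns left multiples into two-sided ones.
  have h := (K * L).add_mem (hK.mul hL _ (left y) v) (left (v * y))
  convert h using 1
  noncomm_ring

theorem ContainsNonzeroIdeal.pow_mul_pow [IsPrimeRing R] {K L : AddSubgroup R}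
    (hK : IsLieIdeal K) (hL : IsLieIdeal L) (hK0 : ∃ a ∈ K, a ≠ 0) (hL0 : ∃ b ∈ L, b ≠ 0)
    (h : ContainsNonzeroIdeal (K * L)) (m n : ℕ+) :
    ContainsNonzeroIdeal (addSubgroupPow K m * addSubgroupPow L n) := by
  induction n using PNat.recOn with
  | one =>
    rw [addSubgroupPow_one]
    induction m using PNat.recOn with
    | one => exact h
    | succ m _ =>
      rw [addSubgroupPow_succ, AddSubgroup.mul_assoc_pointwise]
      exact h.mul_left (hK.pow m) (hK.exists_pow_ne_zero hK0 m)
  | succ n ih =>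
    rw [addSubgroupPow_succ, ← AddSubgroup.mul_assoc_pointwise]
    exact ih.mul_right hL hL0

theorem exists_commutator_ne_zero {a : R} (ha : a ∉ NonUnitalSubring.center R) :
    ∃ r, a * r - r * a ≠ 0 := by
  by_contra! h
  exact ha (NonUnitalSubring.mem_center_iff.2 fun r => (sub_eq_zero.1 (h r)).symm)

theorem addSubgroupPow_le {A : AddSubgroup R} {D : NonUnitalSubring R}
    (h : A ≤ D.toAddSubgroup) (n : ℕ+) : addSubgroupPow A n ≤ D.toAddSubgroup := by
  induction n using PNat.recOn with
  | one => exact h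
  | succ n ih =>
    rw [addSubgroupPow_succ]
    exact AddSubgroup.mul_le_iff.2 fun x hx y hy => D.mul_mem (ih hx) (h hy)

end LieIdeal

/-! ### The extended centroid: Martindale's construction and invertibility. -/

namespace SymmetricQuotientRing

variable {R : Type*} [NonUnitalRing R] [IsPrimeRing R]

theorem of_injective : Function.Injective (of R) := by
  intro r s h
  obtain ⟨J, hJ, _, _, h⟩ := mk_eq_mk.1 h
  refine sub_eq_zero.1 (IsPrimeRing.eq_zero_of_forall_mul_mem hJ fun x hx => ?_)
  rw [sub_mul, sub_eq_zero]
  exact (h x hx).1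

theorem mk_mul_of (p : MartindaleTriple R) {x : R} (hx : x ∈ p.I) :
    mk p * of R x = of R (p.f x) := by
  refine mk_eq_of_forall fun y hy _ => ⟨p.f_mul x hx y, ?_⟩
  obtain ⟨⟨_, hy'⟩, _⟩ := MartindaleTriple.mem_pre.1 hy.2
  exact (p.balanced y hy' x hx).symm

theorem exists_ideal_mul_of (q : SymmetricQuotientRing R) :
    ∃ I : TwoSidedIdeal R, I ≠ ⊥ ∧ ∀ x ∈ I, ∃ y, q * of R x = of R y := by
  induction q using ind with
  | h p => exact ⟨p.I, p.ne_bot, fun x hx => ⟨_, mk_mul_of p hx⟩⟩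

/-- Balance carries the vanishing of `f` over to `g`: (g x) y = x (f y) = 0 on a nonzero ideal of y.
-/
theorem eq_zero_of_mul_of {q : SymmetricQuotientRing R} {I : TwoSidedIdeal R} (hI : I ≠ ⊥)
    (h : ∀ x ∈ I, q * of R x = 0) : q = 0 := by
  induction q using ind with
  | h p =>
    have hf : ∀ x ∈ I, x ∈ p.I → p.f x = 0 := fun x hx hx' => of_injective <| by
      rw [← mk_mul_of p hx', h x hx, map_zero]
    refine mk_eq_mk.2 (MartindaleTriple.rel_of_agree I hI fun x hx hx' _ => ⟨?_, ?_⟩)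
    · rw [hf x hx hx']
      exact (zero_mul x).symm
    · refine Eq.trans ?_ (mul_zero x).symm
      refine IsPrimeRing.eq_zero_of_forall_mul_mem (IsPrimeRing.inf_ne_bot hI p.ne_bot)
        fun y hy => ?_
      rw [← p.balanced x hx' y hy.2, hf y hy.1 hy.2, mul_zero]

theorem mem_extendedCentroid {q : SymmetricQuotientRing R} :
    q ∈ extendedCentroid R ↔ ∀ g, g * q = q * g :=
  Subring.mem_center_iff

/-- The centralizer of `R` in `Q_s(R)` is the extended centroid. -/
theorem mem_extendedCentroid_of_commute {q : SymmetricQuotientRing R}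
    (h : ∀ r, of R r * q = q * of R r) : q ∈ extendedCentroid R := by
  refine mem_extendedCentroid.2 fun g => ?_
  obtain ⟨I, hI, hg⟩ := exists_ideal_mul_of g
  refine sub_eq_zero.1 (eq_zero_of_mul_of hI fun x hx => ?_)
  obtain ⟨y, hy⟩ := hg x hx
  rw [sub_mul, mul_assoc, mul_assoc, ← h, hy, ← mul_assoc, hy, h, sub_self]

/-- If y = cx lies in `R`, then y t a = x t (ca) = 0 for all t, so primeness gives y = 0. -/
theorem eq_zero_of_mul_of_ne_zero {c : SymmetricQuotientRing R} (hc : c ∈ extendedCentroid R)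
    {a : R} (ha : a ≠ 0) (h : c * of R a = 0) : c = 0 := by
  obtain ⟨I, hI, hcI⟩ := exists_ideal_mul_of c
  refine eq_zero_of_mul_of hI fun x hx => ?_
  obtain ⟨y, hy⟩ := hcI x hx
  rw [hy]
  refine (map_eq_zero_iff _ of_injective).2
    ((IsPrimeRing.eq_zero_or_eq_zero y a fun t => of_injective ?_).resolve_right ha)
  rw [map_mul, map_mul, ← hy, ← mem_extendedCentroid.1 hc, mul_assoc (of R x), mul_assoc (of R x),
    ← mem_extendedCentroid.1 hc (of R t), mul_assoc (of R t), h, mul_zero, mul_zero, map_zero]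

/-- If `p t v₀ = q t u₀` for all `t`, with `p, u₀ ≠ 0`, then some element of the extended centroid
carries `u` to `v` whenever `p t v = q t u` for all `t`. -/
theorem exists_extendedCentroid_mul {p q u₀ v₀ : R} (hp : p ≠ 0) (hu₀ : u₀ ≠ 0)
    (h₀ : ∀ t, p * t * v₀ = q * t * u₀) :
    ∃ c ∈ extendedCentroid R, ∀ u v, (∀ t, p * t * v = q * t * u) → c * of R u = of R v := by
  -- The u for which v exists form an ideal, since t is arbitrary, and v is unique because p ≠ 0. So
  -- u ↦ v is a bimodule map, which serves as both halves of a triple; being bilinear makes it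
  -- central.
  let S : Set R := {u | ∃ v, ∀ t, p * t * v = q * t * u}
  have unique : ∀ u v v', (∀ t, p * t * v = q * t * u) → (∀ t, p * t * v' = q * t * u) →
      v = v' := fun u v v' h h' =>
    sub_eq_zero.1 ((IsPrimeRing.eq_zero_or_eq_zero p (v - v') fun t => by
      rw [mul_sub, h, h', sub_self]).resolve_left hp)
  have add : ∀ {u v u' v'}, (∀ t, p * t * v = q * t * u) → (∀ t, p * t * v' = q * t * u') →
      ∀ t, p * t * (v + v') = q * t * (u + u') := fun h h' t => by
    rw [mul_add, mul_add, h, h']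
  have left : ∀ {u v} (r), (∀ t, p * t * v = q * t * u) →
      ∀ t, p * t * (r * v) = q * t * (r * u) := fun r h t => by
    simpa only [mul_assoc] using h (t * r)
  have right : ∀ {u v} (r), (∀ t, p * t * v = q * t * u) →
      ∀ t, p * t * (v * r) = q * t * (u * r) := fun r h t => by
    rw [← mul_assoc, h, mul_assoc]
  let I : TwoSidedIdeal R := TwoSidedIdeal.mk' S ⟨0, by simp⟩
    (fun ⟨v, hv⟩ ⟨v', hv'⟩ => ⟨v + v', add hv hv'⟩)
    (fun ⟨v, hv⟩ => ⟨-v, by simpa using hv⟩)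
    (fun {r _} ⟨v, hv⟩ => ⟨r * v, left r hv⟩)
    (fun {_ r} ⟨v, hv⟩ => ⟨v * r, right r hv⟩)
  have mem_I : ∀ {u}, u ∈ I ↔ ∃ v, ∀ t, p * t * v = q * t * u := TwoSidedIdeal.mem_mk' _ _ _ _ _ _ _
  choose f hf using fun (u : R) (hu : ∃ v, ∀ t, p * t * v = q * t * u) => hu
  classical
  let φ : R → R := fun u => if hu : ∃ v, ∀ t, p * t * v = q * t * u then f u hu else 0
  have hφ : ∀ {u v}, (∀ t, p * t * v = q * t * u) → φ u = v := fun {u v} h => by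
    have hu : ∃ v, ∀ t, p * t * v = q * t * u := ⟨v, h⟩
    simp only [φ, dif_pos hu]
    exact unique u _ _ (hf u hu) h
  have φ_mul : ∀ x ∈ I, ∀ r, φ (x * r) = φ x * r := fun x hx r => by
    obtain ⟨v, hv⟩ := mem_I.1 hx
    rw [hφ hv, hφ (right r hv)]
  have mul_φ : ∀ x ∈ I, ∀ r, φ (r * x) = r * φ x := fun x hx r => by
    obtain ⟨v, hv⟩ := mem_I.1 hx
    rw [hφ hv, hφ (left r hv)]
  have φ_add : ∀ x ∈ I, ∀ y ∈ I, φ (x + y) = φ x + φ y := fun x hx y hy => by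
    obtain ⟨v, hv⟩ := mem_I.1 hx
    obtain ⟨w, hw⟩ := mem_I.1 hy
    rw [hφ hv, hφ hw, hφ (add hv hw)]
  let T : MartindaleTriple R :=
    { I := I
      f := φ
      g := φ
      ne_bot := IsPrimeRing.ne_bot_of_mem (mem_I.2 ⟨v₀, h₀⟩) hu₀
      f_add := φ_add
      f_mul := φ_mul
      g_add := φ_add
      g_mul := mul_φ
      balanced := fun x hx y hy => by rw [← mul_φ y hy, φ_mul x hx] }
  refine ⟨mk T, mem_extendedCentroid_of_commute fun r => ?_, fun u v h => ?_⟩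
  · refine mk_eq_mk.2 (MartindaleTriple.rel_of_agree I T.ne_bot fun x hx _ _ => ⟨?_, ?_⟩)
    · exact (mul_φ x hx r).symm
    · exact φ_mul x hx r
  · rw [mk_mul_of T (mem_I.2 ⟨v, h⟩)]
    exact congrArg _ (hφ h)

/-- Nonzero elements of the extended centroid are invertible. -/
theorem exists_mul_eq_one {c : SymmetricQuotientRing R} (hc : c ∈ extendedCentroid R)
    (hc0 : c ≠ 0) : ∃ d ∈ extendedCentroid R, d * c = 1 := by
  obtain ⟨I, hI, hcI⟩ := exists_ideal_mul_of c
  obtain ⟨x, hx, hx0⟩ := IsPrimeRing.exists_mem_ne hI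
  obtain ⟨y, hy⟩ := hcI x hx
  have hy0 : y ≠ 0 := by
    rintro rfl
    exact hc0 (eq_zero_of_mul_of_ne_zero hc hx0 (by rw [hy, map_zero]))
  -- With y = cx, this relation yields the element d with dy = x, the inverse of c.
  have key : ∀ t, y * t * x = x * t * y := fun t => of_injective <| by
    rw [map_mul, map_mul, map_mul, map_mul, ← hy, ← mul_assoc, mem_extendedCentroid.1 hc,
      mul_assoc, mul_assoc, ← mul_assoc (of R x), mul_assoc c]
  obtain ⟨d, hd, hdy⟩ := exists_extendedCentroid_mul hy0 hy0 key
  refine ⟨d, hd, sub_eq_zero.1 (eq_zero_of_mul_of_ne_zero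
    (sub_mem (mul_mem hd hc) (one_mem _)) hx0 ?_)⟩
  rw [sub_mul, one_mul, mul_assoc, hy, hdy y x key, sub_self]

end SymmetricQuotientRing

open SymmetricQuotientRing

/-! ### Commuting Lie ideals and the line Ca + C. -/

section ExceptionalLieIdeals

variable {R : Type*} [NonUnitalRing R] [IsPrimeRing R]

/-- If the inner derivations of two elements compose to zero, one is an affine function of the
other over the extended centroid. -/
theorem exists_eq_mul_add {a b : R} (ha : a ∉ NonUnitalSubring.center R)
    (h : ∀ r, a * (b * r - r * b) = (b * r - r * b) * a) :
    of R b ∈ centroidLine a := by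
  obtain ⟨r, hr⟩ := exists_commutator_ne_zero ha
  -- Expand the composite derivation [a,[b,·]] = 0 on the product rs; only the cross terms survive.
  have h1 : ∀ r s, (a * r - r * a) * (b * s - s * b) + (b * r - r * b) * (a * s - s * a) = 0 :=
    fun r s => by
      have e : (a * r - r * a) * (b * s - s * b) + (b * r - r * b) * (a * s - s * a) =
          (a * (b * (r * s) - r * s * b) - (b * (r * s) - r * s * b) * a) -
          (a * (b * r - r * b) - (b * r - r * b) * a) * s -
          r * (a * (b * s - s * b) - (b * s - s * b) * a) := by noncomm_ring
      rw [e, h, h, h]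
      simp
  -- Replace r by rt in `h1` and subtract r times the relation for t. Then c[a,s] = [b,s] for one c
  -- and all s, so b − ca is central.
  have h2 : ∀ s t, (a * r - r * a) * t * (b * s - s * b) =
      -(b * r - r * b) * t * (a * s - s * a) := fun s t => by
    have e : (a * r - r * a) * t * (b * s - s * b) - -(b * r - r * b) * t * (a * s - s * a) =
      ((a * (r * t) - r * t * a) * (b * s - s * b) +
        (b * (r * t) - r * t * b) * (a * s - s * a)) -
      r * ((a * t - t * a) * (b * s - s * b) + (b * t - t * b) * (a * s - s * a)) := by
      noncomm_ring
    rw [h1, h1, mul_zero, sub_zero] at e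
    exact sub_eq_zero.1 e
  obtain ⟨c, hc, hcu⟩ := exists_extendedCentroid_mul hr hr (h2 r)
  refine ⟨c, hc, of R b - c * of R a, mem_extendedCentroid_of_commute fun s => ?_, by abel⟩
  have h3 := hcu _ _ (h2 s)
  have h4 := mem_extendedCentroid.1 hc (of R s)
  simp only [map_sub, map_mul] at h3
  linear_combination (norm := noncomm_ring) h3 - h4 * of R a

theorem add_mem_centroidLine {a : R} {p q : SymmetricQuotientRing R} (hp : p ∈ centroidLine a)
    (hq : q ∈ centroidLine a) : p + q ∈ centroidLine a := by
  obtain ⟨c, hc, d, hd, rfl⟩ := hp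
  obtain ⟨c', hc', d', hd', rfl⟩ := hq
  exact ⟨c + c', add_mem hc hc', d + d', add_mem hd hd', by noncomm_ring⟩

theorem mul_mem_centroidLine {a : R} {c p : SymmetricQuotientRing R}
    (hc : c ∈ extendedCentroid R) (hp : p ∈ centroidLine a) : c * p ∈ centroidLine a := by
  obtain ⟨c', hc', d', hd', rfl⟩ := hp
  exact ⟨c * c', mul_mem hc hc', c * d', mul_mem hc hd', by rw [mul_add, mul_assoc]⟩

theorem mem_centroidLine_of_mem {a : R} {d : SymmetricQuotientRing R}
    (hd : d ∈ extendedCentroid R) : d ∈ centroidLine a :=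
  ⟨0, zero_mem _, d, hd, by rw [zero_mul, zero_add]⟩

theorem centroidLine_subset {a b : R} (h : of R b ∈ centroidLine a) :
    centroidLine b ⊆ centroidLine a := by
  rintro _ ⟨c, hc, d, hd, rfl⟩
  exact add_mem_centroidLine (mul_mem_centroidLine hc h) (mem_centroidLine_of_mem hd)

theorem of_mul_mem_mulExtendedCentroid {A : AddSubgroup R} {a : R} (ha : a ∈ A)
    {c : SymmetricQuotientRing R} (hc : c ∈ extendedCentroid R) :
    of R a * c ∈ mulExtendedCentroid A :=
  AddSubgroup.mul_mem_mul ⟨a, ha, rfl⟩ hc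

theorem of_mem_mulExtendedCentroid {A : AddSubgroup R} {a : R} (ha : a ∈ A) :
    of R a ∈ mulExtendedCentroid A := by
  simpa only [mul_one] using of_mul_mem_mulExtendedCentroid ha (one_mem (extendedCentroid R))

theorem mulExtendedCentroid_mul_mem {A : AddSubgroup R} {q c : SymmetricQuotientRing R}
    (hq : q ∈ mulExtendedCentroid A) (hc : c ∈ extendedCentroid R) :
    q * c ∈ mulExtendedCentroid A := by
  refine AddSubmonoid.mul_induction_on (C := fun q => q * c ∈ mulExtendedCentroid A) hq
    (fun x hx d hd => ?_) fun x y hx hy => ?_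
  · obtain ⟨a, ha, rfl⟩ := hx
    rw [mul_assoc]
    exact of_mul_mem_mulExtendedCentroid ha (mul_mem hd hc)
  · rw [add_mul]
    exact add_mem hx hy

/-- An element all of whose commutators are multiples of it by the extended centroid is central. -/
theorem mem_center_of_commutator_eq_mul {a : R} (h : ∀ r, ∃ c ∈ extendedCentroid R,
    of R (a * r - r * a) = c * of R a) : a ∈ NonUnitalSubring.center R := by
  by_contra ha
  have ha0 : a ≠ 0 := by
    rintro rfl
    exact ha (zero_mem _)
  obtain ⟨r, hr⟩ := exists_commutator_ne_zero ha
  obtain ⟨c, hc, e1⟩ := h r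
  -- [a,ra] = [a,r]a, so this second choice gives ca² = da.
  obtain ⟨d, hd, e2⟩ := h (r * a)
  have hc0 : c ≠ 0 := by
    rintro rfl
    rw [zero_mul, map_eq_zero_iff _ of_injective] at e1
    exact hr e1
  have hcr := mem_extendedCentroid.1 hc (of R r)
  have hca := mem_extendedCentroid.1 hc (of R a)
  have hdr := mem_extendedCentroid.1 hd (of R r)
  have hdc := mem_extendedCentroid.1 hc d
  simp only [map_sub, map_mul] at e1 e2
  have e3 : c * (of R a * of R a) = d * of R a := by
    linear_combination (norm := noncomm_ring) e2 - e1 * of R a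
  -- Commute ca² = da with r: the left side gives 2c²a² = 2dca, the right side dca.
  have e4 : d * c * of R a = 0 := by
    linear_combination (norm := noncomm_ring) d * e1 - hdr * of R a + e3 * of R r - of R r * e3
      + hcr * of R a * of R a - c * of R a * e1 - c * e1 * of R a - c * hca * of R a
      - c * e3 - c * e3 + hdc * of R a + hdc * of R a
  have e5 : d * of R a = 0 := by
    obtain ⟨c', -, hc'⟩ := exists_mul_eq_one hc hc0
    rw [hdc, mul_assoc] at e4
    rw [← one_mul d, ← hc', mul_assoc, mul_assoc, e4, mul_zero]
  have e6 : a * a = 0 := by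
    by_contra haa
    refine hc0 (eq_zero_of_mul_of_ne_zero hc haa ?_)
    rw [map_mul, e3, e5]
  refine (IsPrimeRing.eq_zero_or_eq_zero a a fun s => ?_).elim ha0 ha0
  obtain ⟨k, hk, e7⟩ := h s
  -- a[a,s] = ka² = 0 together with a² = 0 leaves a s a = 0.
  have e8 : of R (a * (a * s - s * a)) = 0 := by
    rw [map_mul, e7, ← mul_assoc, mem_extendedCentroid.1 hk, mul_assoc, ← map_mul, e6, map_zero,
      mul_zero]
  rw [map_eq_zero_iff _ of_injective, mul_sub, ← mul_assoc, e6, zero_mul, zero_sub, neg_eq_zero,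
    ← mul_assoc] at e8
  exact e8

/-- The point is C ⊆ `K`C, for which one nonzero element of C in `K`C suffices. Write [a,r] = ca +
d; then d = [a,r] − ca lies in `K`C. If d were always 0, a would be central by
`mem_center_of_commutator_eq_mul`. -/
theorem mulExtendedCentroid_eq_centroidLine {K : AddSubgroup R} (hK : IsLieIdeal K) {a : R}
    (ha : a ∈ K) (hac : a ∉ NonUnitalSubring.center R) (h : ∀ x ∈ K, of R x ∈ centroidLine a) :
    (mulExtendedCentroid K : Set (SymmetricQuotientRing R)) = centroidLine a := by
  refine Set.Subset.antisymm (fun q hq => ?_) ?_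
  · refine AddSubmonoid.mul_induction_on (C := fun q => q ∈ centroidLine a) hq
      (fun x hx d hd => ?_) fun x y hx hy => add_mem_centroidLine hx hy
    obtain ⟨x, hx, rfl⟩ := hx
    rw [mem_extendedCentroid.1 hd]
    exact mul_mem_centroidLine hd (h x hx)
  · obtain ⟨e, he, he0, heK⟩ : ∃ e ∈ extendedCentroid R, e ≠ 0 ∧ e ∈ mulExtendedCentroid K := by
      by_contra! h'
      refine hac (mem_center_of_commutator_eq_mul fun r => ?_)
      obtain ⟨c, hc, d, hd, e⟩ := h _ (hK a ha r)
      have hd0 : d = 0 := by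
        by_contra hd0
        refine h' d hd hd0 ?_
        rw [← add_sub_cancel_left (c * of R a) d, ← e, ← mem_extendedCentroid.1 hc]
        exact sub_mem (of_mem_mulExtendedCentroid (hK a ha r))
          (of_mul_mem_mulExtendedCentroid ha hc)
      exact ⟨c, hc, by rw [e, hd0, add_zero]⟩
    obtain ⟨e', he', hee⟩ := exists_mul_eq_one he he0
    rintro _ ⟨c, hc, d, hd, rfl⟩
    refine add_mem ?_ ?_
    · rw [← mem_extendedCentroid.1 hc]
      exact of_mul_mem_mulExtendedCentroid ha hc
    · have hd' : d = e * (e' * d) := by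
        rw [← mul_assoc, mem_extendedCentroid.1 he', hee, one_mul]
      rw [hd']
      exact mulExtendedCentroid_mul_mem heK (mul_mem he' hd)

/-- If two noncentral Lie ideals commute elementwise, they generate the same line. -/
theorem mulExtendedCentroid_eq_of_commute {K L : AddSubgroup R} (hK : IsLieIdeal K)
    (hL : IsLieIdeal L) (hLc : ¬ IsCentral L) (h : ∀ a ∈ K, ∀ b ∈ L, a * b = b * a) {a : R}
    (ha : a ∈ K) (hac : a ∉ NonUnitalSubring.center R) :
    (mulExtendedCentroid K : Set (SymmetricQuotientRing R)) = centroidLine a ∧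
      (mulExtendedCentroid L : Set (SymmetricQuotientRing R)) = centroidLine a := by
  have hLK : ∀ x ∈ K, x ∉ NonUnitalSubring.center R → ∀ y ∈ L, of R y ∈ centroidLine x :=
    fun x hx hxc y hy => exists_eq_mul_add hxc fun r => h x hx _ (hL y hy r)
  have hKL : ∀ y ∈ L, y ∉ NonUnitalSubring.center R → ∀ x ∈ K, of R x ∈ centroidLine y :=
    fun y hy hyc x hx => exists_eq_mul_add hyc fun r => (h _ (hK x hx r) y hy).symm
  obtain ⟨b, hb, hbc⟩ : ∃ b ∈ L, b ∉ NonUnitalSubring.center R := by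
    simpa only [IsCentral, not_forall, exists_prop] using hLc
  have hab : centroidLine a = centroidLine b :=
    (centroidLine_subset (hKL b hb hbc a ha)).antisymm
      (centroidLine_subset (hLK a ha hac b hb))
  refine ⟨mulExtendedCentroid_eq_centroidLine hK ha hac fun x hx => ?_, ?_⟩
  · rw [hab]
    exact hKL b hb hbc x hx
  · rw [hab]
    refine mulExtendedCentroid_eq_centroidLine hL hb hbc fun y hy => ?_
    rw [← hab]
    exact hLK a ha hac y hy

/-- Ca + C need not be closed under products; the double centralizer is a subring containing it. -/
theorem centroidLine_subset_doubleCentralizer (a : R) : centroidLine a ⊆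
    (Subring.centralizer (Subring.centralizer {of R a} : Set (SymmetricQuotientRing R)) :
      Set (SymmetricQuotientRing R)) := by
  rintro _ ⟨c, hc, d, hd, rfl⟩
  refine add_mem (mul_mem ?_ ?_) ?_
  · exact Subring.center_le_centralizer _ hc
  · exact fun g hg => ((Subring.mem_centralizer_iff.1 hg) _ rfl).symm
  · exact Subring.center_le_centralizer _ hd

theorem not_containsNonzeroIdeal {K L : AddSubgroup R} {a : R}
    (hac : a ∉ NonUnitalSubring.center R) (hK : ∀ x ∈ K, of R x ∈ centroidLine a)
    (hL : ∀ x ∈ L, of R x ∈ centroidLine a) (m n : ℕ+) :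
    ¬ ContainsNonzeroIdeal (addSubgroupPow K m * addSubgroupPow L n) := by
  rintro ⟨I, hI, hIKL⟩
  let S := Subring.centralizer (Subring.centralizer {of R a} : Set (SymmetricQuotientRing R))
  let D : NonUnitalSubring R := S.toNonUnitalSubring.comap (of R)
  have hD : addSubgroupPow K m * addSubgroupPow L n ≤ D.toAddSubgroup :=
    AddSubgroup.mul_le_iff.2 fun _ hx _ hy => D.mul_mem
      (addSubgroupPow_le (D := D)
        (fun x hx => centroidLine_subset_doubleCentralizer a (hK x hx)) m hx)
      (addSubgroupPow_le (D := D)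
        (fun x hx => centroidLine_subset_doubleCentralizer a (hL x hx)) n hy)
  have hIS : ∀ x ∈ I, of R x ∈ S := fun x hx => hD (hIKL x hx)
  have ha : of R a ∈ Subring.centralizer {of R a} := by
    rintro _ rfl
    rfl
  -- Since a centralizes itself, x commutes with a; then y, in the double centralizer, commutes with
  -- x.
  have comm : ∀ x ∈ I, ∀ y ∈ I, x * y = y * x := fun x hx y hy => of_injective <| by
    rw [map_mul, map_mul]
    refine hIS y hy _ fun g hg => ?_
    rw [Set.mem_singleton_iff.1 hg]
    exact hIS x hx _ ha
  exact hac (NonUnitalSubring.mem_center_iff.2 fun r => IsPrimeRing.mul_comm_of_ideal hI comm r a)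

end ExceptionalLieIdeals

theorem mainTheorem6 {R : Type*} [NonUnitalRing R] [IsPrimeRing R] (K L : AddSubgroup R)
    (hK : IsLieIdeal K) (hL : IsLieIdeal L) (hKc : ¬ IsCentral K) (hLc : ¬ IsCentral L)
    (m n : ℕ+) :
    ContainsNonzeroIdeal (addSubgroupPow K m * addSubgroupPow L n) ↔
      ¬ ∀ a ∈ K, a ∉ NonUnitalSubring.center R →
        (mulExtendedCentroid K : Set (SymmetricQuotientRing R)) = centroidLine a ∧
        (mulExtendedCentroid L : Set (SymmetricQuotientRing R)) = centroidLine a := by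
  have exists_noncentral : ∃ a ∈ K, a ∉ NonUnitalSubring.center R := by
    simpa only [IsCentral, not_forall, exists_prop] using hKc
  constructor
  · intro hI h
    obtain ⟨a, ha, hac⟩ := exists_noncentral
    obtain ⟨h1, h2⟩ := h a ha hac
    exact not_containsNonzeroIdeal hac (fun x hx => h1 ▸ of_mem_mulExtendedCentroid hx)
      (fun x hx => h2 ▸ of_mem_mulExtendedCentroid hx) m n hI
  · intro h
    by_cases hcomm : ∀ a ∈ K, ∀ b ∈ L, a * b = b * a
    · exact absurd (fun a ha hac => mulExtendedCentroid_eq_of_commute hK hL hLc hcomm ha hac) h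
    · push Not at hcomm
      obtain ⟨a, ha, b, hb, hab⟩ := hcomm
      exact (containsNonzeroIdeal_mul_of_ne hK hL ha hb hab).pow_mul_pow hK hL
        (exists_ne_zero_of_not_isCentral hKc) (exists_ne_zero_of_not_isCentral hLc) m n
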